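/- Let $k\ge 0$ and, for $i=1,\dots,k$, let $\mathcal H_i,\mathcal K_i$ be finite-dimensional complex Hilbert spaces, let $\sim$ be any fixed symmetric neighboring relation on the density operators on $\mathcal H_i$ (it may depend on $i$), and let $A_i$ be a quantum channel (completely positive trace-preserving map) from $\mathcal H_i$ to $\mathcal K_i$. Let $\varepsilon_i\ge 0$ and $\delta_i\in[0,1]$, and suppose that $A_i$ is $(\varepsilon_i,\delta_i)$-QDP, i.e. $$\mathrm{Tr}[M A_i(\rho)]\le e^{\varepsilon_i}\,\mathrm{Tr}[M A_i(\sigma)]+\delta_i$$ for all density operators $\rho\sim\sigma$ on $\mathcal H_i$ and all operators $0\preceq M\preceq I$ on $\mathcal K_i$. Let $\mathcal M_{\mathrm{LO}^*}$ be the set of all operators on $\mathcal K_1\otimes\cdots\otimes\mathcal K_k$ of the form $$M=\sum_{z_1,\dots,z_k}T(z_1,\dots,z_k)\,M_1^{z_1}\otimes\cdots\otimes M_k^{z_k},$$ where, for each $i$, $\{M_i^{z_i}\}_{z_i\in\mathcal Z_i}$ is a POVM on $\mathcal K_i$ with a finite outcome set $\mathcal Z_i$, and $T:\mathcal Z_1\times\cdots\times\mathcal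 Z_k\to[0,1]$ is an arbitrary function (local measurements followed by classical post-processing). Then for every $\delta\in(0,1)$, all density operators $\rho_i\sim\sigma_i$ on $\mathcal H_i$ ($i=1,\dots,k$), and every $M\in\mathcal M_{\mathrm{LO}^*}$, $$\mathrm{Tr}\Big[M\bigotimes_{i=1}^kA_i(\rho_i)\Big]\le e^{\bar\varepsilon}\,\mathrm{Tr}\Big[M\bigotimes_{i=1}^kA_i(\sigma_i)\Big]+\bar\delta,$$ where $$\bar\varepsilon=\min\left\{\sum_{i=1}^k\varepsilon_i,\ \sum_{i=1}^k\varepsilon_i\,\frac{e^{\varepsilon_i}-1}{e^{\varepsilon_i}+1}+\sqrt{2\sum_{i=1}^k\varepsilon_i^2\;\min\left\{\log\frac1\delta,\ \log\left(e+\frac{\sqrt{\sum_{i=1}^k\varepsilon_i^2}}{\delta}\right)\right\}}\ \right\},\qquad \bar\delta=1-(1-\delta)\prod_{i=1}^k(1-\delta_i).$$ -/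

import Mathlib

open scoped ComplexOrder TensorProduct

noncomputable section

namespace QDP

/-- A density operator (quantum state): a positive semidefinite operator of trace one. -/
structure DensityOp (H : Type*) [NormedAddCommGroup H] [InnerProductSpace ℂ H] where
  op : H →ₗ[ℂ] H
  pos : op.IsPositive
  trace_eq_one : LinearMap.trace ℂ H op = 1

/-- Positivity of an `n × n` block operator `(X a b)` with entries in `L(H)`, regarded as an
operator on the direct sum of `n` copies of `H`, i.e. as an element of `Mₙ ⊗ L(H)`.
(In the order of `ℂ`, `0 ≤ z` says that `z` is real and nonnegative.) -/
def BlockPositive {H : Type*} [NormedAddCommGroup H] [InnerProductSpace ℂ H] {n : ℕ}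
    (X : Fin n → Fin n → (H →ₗ[ℂ] H)) : Prop :=
  ∀ v : Fin n → H, 0 ≤ ∑ a, ∑ b, inner ℂ (v a) (X a b (v b))

/-- A quantum channel from `L(H)` to `L(K)`: a linear map that is completely positive (every
ampliation `id_{Mₙ} ⊗ Φ` preserves positivity) and trace preserving. -/
structure Channel (H K : Type*) [NormedAddCommGroup H] [InnerProductSpace ℂ H]
    [NormedAddCommGroup K] [InnerProductSpace ℂ K] where
  toLin : (H →ₗ[ℂ] H) →ₗ[ℂ] (K →ₗ[ℂ] K)
  completelyPositive : ∀ (n : ℕ) (X : Fin n → Fin n → (H →ₗ[ℂ] H)),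
    BlockPositive X → BlockPositive (fun a b => toLin (X a b))
  tracePreserving : ∀ X : H →ₗ[ℂ] H,
    LinearMap.trace ℂ K (toLin X) = LinearMap.trace ℂ H X

/-- A channel sends positive operators to positive operators. -/
theorem Channel.isPositive_toLin {H K : Type*} [NormedAddCommGroup H] [InnerProductSpace ℂ H]
    [NormedAddCommGroup K] [InnerProductSpace ℂ K] (A : Channel H K)
    {X : H →ₗ[ℂ] H} (hX : X.IsPositive) : (A.toLin X).IsPositive := by
  have h := A.completelyPositive 1 (fun _ _ => X) (fun v => by
    simpa using hX.inner_nonneg_right (v 0))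
  rw [LinearMap.isPositive_iff_complex]
  intro x
  have hx : 0 ≤ inner ℂ x (A.toLin X x) := by simpa using h (fun _ => x)
  have hx' : 0 ≤ inner ℂ (A.toLin X x) x := by
    rw [← inner_conj_symm]
    exact star_nonneg_iff.mpr hx
  rw [Complex.nonneg_iff] at hx'
  refine ⟨?_, hx'.1⟩
  apply Complex.ext
  · simp
  · simpa using hx'.2

/-- The action of a channel on states. -/
def Channel.onState {H K : Type*} [NormedAddCommGroup H] [InnerProductSpace ℂ H]
    [NormedAddCommGroup K] [InnerProductSpace ℂ K] (A : Channel H K) (ρ : DensityOp H) :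
    DensityOp K where
  op := A.toLin ρ.op
  pos := A.isPositive_toLin ρ.pos
  trace_eq_one := (A.tracePreserving ρ.op).trans ρ.trace_eq_one

/-- The number `Tr[M X]`; it is real for self-adjoint `M` and `X`, which is the only case in
which it is used, and is read as a real number. -/
def trMul {V : Type*} [AddCommGroup V] [Module ℂ V] (M X : V →ₗ[ℂ] V) : ℝ :=
  (LinearMap.trace ℂ V (M ∘ₗ X)).re

/-- A measurement operator (effect): `0 ≤ M ≤ I`. -/
def IsEffect {K : Type*} [NormedAddCommGroup K] [InnerProductSpace ℂ K]
    (M : K →ₗ[ℂ] K) : Prop :=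
  M.IsPositive ∧ (LinearMap.id - M).IsPositive

/-- `(ε, δ)`-quantum differential privacy of a channel, with respect to the neighboring
relation `N` on input states. -/
def IsQDP {H K : Type*} [NormedAddCommGroup H] [InnerProductSpace ℂ H]
    [NormedAddCommGroup K] [InnerProductSpace ℂ K]
    (N : DensityOp H → DensityOp H → Prop) (ε δ : ℝ) (A : Channel H K) : Prop :=
  ∀ ρ σ : DensityOp H, N ρ σ → ∀ M : K →ₗ[ℂ] K, IsEffect M →
    trMul M (A.onState ρ).op ≤ Real.exp ε * trMul M (A.onState σ).op + δ

/-- A POVM on `K` with a finite outcome set `Z`. -/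
structure POVM (K : Type*) [NormedAddCommGroup K] [InnerProductSpace ℂ K]
    (Z : Type*) [Fintype Z] where
  op : Z → (K →ₗ[ℂ] K)
  pos : ∀ z, (op z).IsPositive
  sum_eq_id : ∑ z, op z = LinearMap.id

/-- The tensor product `X₁ ⊗ ⋯ ⊗ Xₖ` of operators, acting on `K₁ ⊗ ⋯ ⊗ Kₖ`. -/
def tensorOp {k : ℕ} {K : Fin k → Type*} [∀ i, NormedAddCommGroup (K i)]
    [∀ i, InnerProductSpace ℂ (K i)] (X : ∀ i, K i →ₗ[ℂ] K i) :
    (⨂[ℂ] i, K i) →ₗ[ℂ] (⨂[ℂ] i, K i) :=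
  PiTensorProduct.map X

/-- The tests `∑_z T(z) M₁^{z₁} ⊗ ⋯ ⊗ Mₖ^{zₖ}` given by local POVMs (the `i`-th one with finite
outcome set `{0, …, n i - 1}`) followed by classical post-processing `T` with values in `[0, 1]`. -/
def LOStar {k : ℕ} (K : Fin k → Type*) [∀ i, NormedAddCommGroup (K i)]
    [∀ i, InnerProductSpace ℂ (K i)] :
    Set ((⨂[ℂ] i, K i) →ₗ[ℂ] (⨂[ℂ] i, K i)) :=
  {M | ∃ (n : Fin k → ℕ) (P : ∀ i, POVM (K i) (Fin (n i))) (T : (∀ i, Fin (n i)) → ℝ),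
    (∀ z, T z ∈ Set.Icc (0 : ℝ) 1) ∧
    M = ∑ z : (∀ i, Fin (n i)), (T z : ℂ) • tensorOp (fun i => (P i).op (z i))}

/-- The advanced-composition privacy parameter `ε̄`. -/
def epsBar {k : ℕ} (ε : Fin k → ℝ) (δ : ℝ) : ℝ :=
  min (∑ i, ε i)
    (∑ i, ε i * ((Real.exp (ε i) - 1) / (Real.exp (ε i) + 1)) +
      √(2 * (∑ i, ε i ^ 2) *
        min (Real.log (1 / δ)) (Real.log (Real.exp 1 + √(∑ i, ε i ^ 2) / δ))))

/-- The advanced-composition failure parameter `δ̄`. -/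
def deltaBar {k : ℕ} (δs : Fin k → ℝ) (δ : ℝ) : ℝ :=
  1 - (1 - δ) * ∏ i, (1 - δs i)

end QDP

end

/-!
A test built from local POVMs and classical post-processing sees a product state only through the
product of the local outcome distributions (`QDP.trMul_sum_tensorOp`), since the trace is
multiplicative on tensor products of operators (`QDP.trace_piTensorProduct_map`). Every event of a
local measurement is an effect, so quantum differential privacy of `A i` makes the outcome
distributions `p i`, `q i` on the two inputs classically `(ε i, δs i)`-indistinguishable, in both
directions because the neighboring relation is symmetric. What remains is the advanced composition
theorem of Kairouz, Oh and Viswanath for finite distributions, in its heterogeneous form.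

Its proof first removes the additive errors. By truncating `p` at `exp ε * q` and `q` at
`exp ε * p`, and then equalizing the masses, one finds pointwise `ε`-indistinguishable
distributions `p'`, `q'` with `(1 - δ) p' ≤ p` and `(1 - δ) q' ≤ q` (`QDP.exists_indist_le`). In a
product, the part not covered by these minorants has mass `1 - ∏ i, (1 - δs i)`, which accounts
for `QDP.deltaBar` (`QDP.sum_mul_prod_le_deltaBar`).

For pointwise indistinguishable pairs the total privacy loss `L = ∑ i, log (p i / q i)` is, under
the product of the `p i`, a sum of independent terms bounded by `ε i`. Their means are at most
`ε i (exp (ε i) - 1) / (exp (ε i) + 1)`, because `r log r` lies below its chord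
(`QDP.Indist.sum_mul_log_le`), and Hoeffding's lemma bounds their exponential moments
(`QDP.sum_mul_exp_le`). The failure probability at privacy level `e` is the mean of the positive
part of `1 - exp (e - L)`. The inequality `1 - exp (-x) ≤ exp (t x) / (1 + t)` turns the moment
bound into a Chernoff bound with an additional factor `1 / (1 + t)`
(`QDP.sum_mul_prod_le_chernoff`). Dropping the factor gives the term `log (1 / δ)` of
`QDP.epsBar`; keeping it gives the term `log (exp 1 + √(∑ i, ε i ^ 2) / δ)`
(`QDP.chernoff_remainder_le`).
-/

namespace QDP

/-! ### Privacy loss of a pair of finite distributions -/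

/-- Pointwise indistinguishability of two weight functions: each is at most `exp ε` times the
other. For probability distributions this is pure differential privacy. -/
def Indist {α : Type*} (ε : ℝ) (p q : α → ℝ) : Prop :=
  ∀ a, p a ≤ Real.exp ε * q a ∧ q a ≤ Real.exp ε * p a

theorem Indist.eq_zero_or_pos {α : Type*} {ε : ℝ} {p q : α → ℝ} (h : Indist ε p q)
    (hp : ∀ a, 0 ≤ p a) (hq : ∀ a, 0 ≤ q a) (a : α) :
    (p a = 0 ∧ q a = 0) ∨ (0 < p a ∧ 0 < q a) := by
  have hε := Real.exp_pos ε
  rcases (hp a).eq_or_lt with h0 | h0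
  · left
    refine ⟨h0.symm, le_antisymm ?_ (hq a)⟩
    simpa [← h0] using (h a).2
  · right
    refine ⟨h0, pos_of_mul_pos_right (h0.trans_le (h a).1) hε.le⟩

theorem Indist.abs_log_div_le {α : Type*} {ε : ℝ} (hε : 0 ≤ ε) {p q : α → ℝ}
    (h : Indist ε p q) (hp : ∀ a, 0 ≤ p a) (hq : ∀ a, 0 ≤ q a) (a : α) :
    |Real.log (p a / q a)| ≤ ε := by
  rcases h.eq_zero_or_pos hp hq a with ⟨h1, h2⟩ | ⟨h1, h2⟩
  · simpa [h1, h2] using hε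
  · rw [Real.log_div h1.ne' h2.ne', abs_le]
    have e1 := Real.log_le_log h1 (h a).1
    have e2 := Real.log_le_log h2 (h a).2
    rw [Real.log_mul (Real.exp_pos _).ne' h2.ne', Real.log_exp] at e1
    rw [Real.log_mul (Real.exp_pos _).ne' h1.ne', Real.log_exp] at e2
    constructor <;> linarith

/-- On `[exp (-ε), exp ε]` the convex function `r * log r` lies below its chord. -/
theorem mul_log_le_chord {ε r : ℝ} (hε : 0 ≤ ε) (h1 : Real.exp (-ε) ≤ r)
    (h2 : r ≤ Real.exp ε) :
    r * Real.log r ≤ ε * ((Real.exp ε - 1) / (Real.exp ε + 1)) +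
      ε * ((Real.exp ε ^ 2 + 1) / (Real.exp ε ^ 2 - 1)) * (r - 1) := by
  rcases hε.eq_or_lt with rfl | hε
  · have : r = 1 := le_antisymm (by simpa using h2) (by simpa using h1)
    simp [this]
  set E := Real.exp ε with hE
  have hE1 : 1 < E := Real.one_lt_exp_iff.mpr hε
  have hEi : Real.exp (-ε) = E⁻¹ := Real.exp_neg ε
  rw [hEi] at h1
  have hlt : 0 < E ^ 2 - 1 := by nlinarith
  have hE0 : 0 < E := by linarith
  -- `w` is the weight of the right end point in the representation of `r` as a convex combination
  set w := (r * E - 1) / (E ^ 2 - 1) with hw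
  have hrE : 1 ≤ r * E := by
    have := mul_le_mul_of_nonneg_right h1 hE0.le
    rwa [inv_mul_cancel₀ hE0.ne'] at this
  have hw0 : 0 ≤ w := div_nonneg (by linarith) hlt.le
  have hw1 : 0 ≤ 1 - w := by
    rw [sub_nonneg, hw, div_le_one hlt]
    nlinarith
  have hc := Real.convexOn_mul_log.2 (x := E) (y := E⁻¹) (Set.mem_Ici.mpr hE0.le)
    (Set.mem_Ici.mpr (inv_nonneg.mpr hE0.le)) hw0 hw1 (by ring)
  have hr : w • E + (1 - w) • E⁻¹ = r := by
    simp only [smul_eq_mul, hw]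
    field_simp
    ring
  rw [hr] at hc
  refine hc.trans (le_of_eq ?_)
  have hl : Real.log E = ε := Real.log_exp ε
  have hEm : E - 1 ≠ 0 := by linarith
  have hEp : E + 1 ≠ 0 := by linarith
  have hfac : E ^ 2 - 1 = (E - 1) * (E + 1) := by ring
  simp only [smul_eq_mul, Real.log_inv, hl, hw, hfac]
  field_simp
  ring

/-- The Kullback–Leibler divergence of two `ε`-indistinguishable distributions is at most
`ε (exp ε - 1) / (exp ε + 1)`, the value attained by randomized response. -/
theorem Indist.sum_mul_log_le {α : Type*} [Fintype α] {ε : ℝ} (hε : 0 ≤ ε) {p q : α → ℝ}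
    (h : Indist ε p q) (hp : ∀ a, 0 ≤ p a) (hq : ∀ a, 0 ≤ q a)
    (hp1 : ∑ a, p a = 1) (hq1 : ∑ a, q a = 1) :
    ∑ a, p a * Real.log (p a / q a) ≤ ε * ((Real.exp ε - 1) / (Real.exp ε + 1)) := by
  set c := ε * ((Real.exp ε - 1) / (Real.exp ε + 1))
  set d := ε * ((Real.exp ε ^ 2 + 1) / (Real.exp ε ^ 2 - 1))
  calc ∑ a, p a * Real.log (p a / q a) ≤ ∑ a, (q a * c + d * (p a - q a)) := by
        refine Finset.sum_le_sum fun a _ => ?_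
        rcases h.eq_zero_or_pos hp hq a with ⟨h1, h2⟩ | ⟨h1, h2⟩
        · simp [h1, h2]
        · have hb1 : Real.exp (-ε) ≤ p a / q a := by
            rw [Real.exp_neg, le_div_iff₀ h2, inv_mul_le_iff₀ (Real.exp_pos _)]
            exact (h a).2
          have hb2 : p a / q a ≤ Real.exp ε := by
            rw [div_le_iff₀ h2]
            exact (h a).1
          have := mul_le_mul_of_nonneg_left (mul_log_le_chord hε hb1 hb2) h2.le
          calc p a * Real.log (p a / q a)
              = q a * (p a / q a * Real.log (p a / q a)) := by field_simp
            _ ≤ q a * (c + d * (p a / q a - 1)) := this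
            _ = q a * c + d * (p a - q a) := by field_simp
    _ = c := by
        rw [Finset.sum_add_distrib, ← Finset.sum_mul, ← Finset.mul_sum,
          Finset.sum_sub_distrib, hp1, hq1]
        ring

/-- Hoeffding's lemma for a finite distribution: a function bounded by `ε` in absolute value
whose mean is at most `m` has exponential moments at most those of a Gaussian variable with
mean `m` and variance `ε ^ 2`. -/
theorem sum_mul_exp_le {α : Type*} [Fintype α] {p L : α → ℝ} {ε m t : ℝ}
    (hp : ∀ a, 0 ≤ p a) (hp1 : ∑ a, p a = 1) (hL : ∀ a, |L a| ≤ ε)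
    (hm : ∑ a, p a * L a ≤ m) (ht : 0 ≤ t) :
    ∑ a, p a * Real.exp (t * L a) ≤ Real.exp (t * m + t ^ 2 * ε ^ 2 / 2) := by
  let _ : MeasurableSpace α := ⊤
  let P : PMF α := PMF.ofFintype (fun a => ENNReal.ofReal (p a)) (by
    rw [← ENNReal.ofReal_sum_of_nonneg fun a _ => hp a, hp1, ENNReal.ofReal_one])
  have hint : ∀ f : α → ℝ, ∫ a, f a ∂P.toMeasure = ∑ a, p a * f a := fun f => by
    rw [PMF.integral_eq_sum]
    simp [P, ENNReal.toReal_ofReal (hp _)]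
  have hsub := ProbabilityTheory.hasSubgaussianMGF_of_mem_Icc (μ := P.toMeasure) (X := L)
    (a := -ε) (b := ε) (measurable_from_top.aemeasurable)
    (Filter.Eventually.of_forall fun a => abs_le.mp (hL a))
  have h := hsub.mgf_le t
  rw [ProbabilityTheory.mgf, hint, hint] at h
  have hc : (((‖ε - -ε‖₊ / 2) ^ 2 : NNReal) : ℝ) = ε ^ 2 := by
    simp only [NNReal.coe_pow, NNReal.coe_div, coe_nnnorm, Real.norm_eq_abs, NNReal.coe_ofNat,
      div_pow, sq_abs]
    ring
  rw [hc] at h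
  set μ := ∑ a, p a * L a
  calc ∑ a, p a * Real.exp (t * L a)
      = Real.exp (t * μ) * ∑ a, p a * Real.exp (t * (L a - μ)) := by
        rw [Finset.mul_sum]
        refine Finset.sum_congr rfl fun a _ => ?_
        rw [mul_left_comm, ← Real.exp_add]
        ring_nf
    _ ≤ Real.exp (t * μ) * Real.exp (ε ^ 2 * t ^ 2 / 2) := by gcongr
    _ ≤ Real.exp (t * m + t ^ 2 * ε ^ 2 / 2) := by
        rw [← Real.exp_add, Real.exp_le_exp]
        nlinarith [mul_le_mul_of_nonneg_left hm ht]

/-! ### Composition of pure differential privacy -/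

/-- The Chernoff-type bound on the hockey-stick function. It is sharper than
`1 - exp (-x) ≤ exp (t * x)` by the factor `1 + t`. -/
theorem one_sub_exp_neg_le {t : ℝ} (ht : 0 ≤ t) (x : ℝ) :
    1 - Real.exp (-x) ≤ Real.exp (t * x) / (1 + t) := by
  rw [le_div_iff₀ (by linarith)]
  have h1 := Real.add_one_le_exp (t * x)
  have h2 := Real.add_one_le_exp (-x)
  linarith [mul_le_mul_of_nonneg_left h2 ht, Real.exp_pos (-x)]

/-- Gaussian-type tail bound for the composition of `ε i`-indistinguishable pairs, at privacy
level `(mean bound) + s` and with a free Chernoff parameter `t`. -/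
theorem sum_mul_prod_le_chernoff {ι : Type*} [Fintype ι] [DecidableEq ι] {α : ι → Type*}
    [∀ i, Fintype (α i)] {ε : ι → ℝ} (hε : ∀ i, 0 ≤ ε i) {p q : ∀ i, α i → ℝ}
    (h : ∀ i, Indist (ε i) (p i) (q i))
    (hp : ∀ i a, 0 ≤ p i a) (hq : ∀ i a, 0 ≤ q i a)
    (hp1 : ∀ i, ∑ a, p i a = 1) (hq1 : ∀ i, ∑ a, q i a = 1)
    {T : (∀ i, α i) → ℝ} (hT : ∀ z, T z ∈ Set.Icc (0 : ℝ) 1) {t : ℝ} (ht : 0 ≤ t) (s : ℝ) :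
    ∑ z, T z * ∏ i, p i (z i) ≤
      Real.exp (∑ i, ε i * ((Real.exp (ε i) - 1) / (Real.exp (ε i) + 1)) + s) *
        ∑ z, T z * ∏ i, q i (z i) +
      Real.exp (t ^ 2 * (∑ i, ε i ^ 2) / 2 - t * s) / (1 + t) := by
  set m := ∑ i, ε i * ((Real.exp (ε i) - 1) / (Real.exp (ε i) + 1)) with hm
  let L : ∀ i, α i → ℝ := fun i a => Real.log (p i a / q i a)
  have hpt : ∀ z : (∀ i, α i), T z * ∏ i, p i (z i) ≤
      Real.exp (m + s) * (T z * ∏ i, q i (z i)) +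
        Real.exp (-(t * (m + s))) / (1 + t) * ∏ i, (p i (z i) * Real.exp (t * L i (z i))) := by
    intro z
    have hq0 : 0 ≤ ∏ i, q i (z i) := Finset.prod_nonneg fun i _ => hq i _
    have hp0 : 0 ≤ ∏ i, p i (z i) := Finset.prod_nonneg fun i _ => hp i _
    have hr0 : 0 ≤ Real.exp (-(t * (m + s))) / (1 + t) *
        ∏ i, (p i (z i) * Real.exp (t * L i (z i))) := by
      refine mul_nonneg (div_nonneg (Real.exp_pos _).le (by linarith))
        (Finset.prod_nonneg fun i _ => mul_nonneg (hp i _) (Real.exp_pos _).le)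
    by_cases hz : ∃ i, p i (z i) = 0
    · obtain ⟨i, hi⟩ := hz
      rw [Finset.prod_eq_zero (f := fun i => p i (z i)) (Finset.mem_univ i) hi, mul_zero]
      exact add_nonneg (mul_nonneg (Real.exp_pos _).le (mul_nonneg (hT z).1 hq0)) hr0
    · push Not at hz
      -- where the weights are positive, the likelihood ratio is the exponential of the total loss
      have hqp : ∏ i, q i (z i) = (∏ i, p i (z i)) * Real.exp (-∑ i, L i (z i)) := by
        rw [← Finset.sum_neg_distrib, Real.exp_sum, ← Finset.prod_mul_distrib]
        refine Finset.prod_congr rfl fun i _ => ?_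
        rcases (h i).eq_zero_or_pos (hp i) (hq i) (z i) with h0 | ⟨h1, h2⟩
        · exact absurd h0.1 (hz i)
        · rw [Real.exp_neg, Real.exp_log (div_pos h1 h2)]
          field_simp
      have hrp : ∏ i, (p i (z i) * Real.exp (t * L i (z i))) =
          (∏ i, p i (z i)) * Real.exp (t * ∑ i, L i (z i)) := by
        rw [Finset.prod_mul_distrib, Finset.mul_sum, Real.exp_sum]
      set S := ∑ i, L i (z i)
      have hk := one_sub_exp_neg_le ht (S - (m + s))
      have e1 : Real.exp (m + s) * Real.exp (-S) = Real.exp (-(S - (m + s))) := by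
        rw [← Real.exp_add]; ring_nf
      have e2 : Real.exp (-(t * (m + s))) * Real.exp (t * S) = Real.exp (t * (S - (m + s))) := by
        rw [← Real.exp_add]; ring_nf
      set D := Real.exp (t * (S - (m + s))) / (1 + t) with hD
      have hD0 : 0 ≤ D := div_nonneg (Real.exp_pos _).le (by linarith)
      have hTD : T z * (1 - Real.exp (-(S - (m + s)))) ≤ D :=
        (mul_le_mul_of_nonneg_left hk (hT z).1).trans (mul_le_of_le_one_left hD0 (hT z).2)
      rw [hrp, hqp]
      have hgoal := mul_le_mul_of_nonneg_left hTD hp0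
      have e3 : Real.exp (-(t * (m + s))) / (1 + t) *
          ((∏ i, p i (z i)) * Real.exp (t * S)) = (∏ i, p i (z i)) * D := by
        rw [hD, ← e2]; ring
      have e4 : Real.exp (m + s) * (T z * ((∏ i, p i (z i)) * Real.exp (-S))) =
          (∏ i, p i (z i)) * (T z * Real.exp (-(S - (m + s)))) := by
        rw [← e1]; ring
      rw [e3, e4]
      linarith
  have hmgf : ∑ z : (∀ i, α i), ∏ i, (p i (z i) * Real.exp (t * L i (z i))) ≤
      Real.exp (t * m + t ^ 2 * (∑ i, ε i ^ 2) / 2) := by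
    have hswap : ∑ z : (∀ i, α i), ∏ i, (p i (z i) * Real.exp (t * L i (z i))) =
        ∏ i, ∑ a, p i a * Real.exp (t * L i a) := by
      rw [Finset.prod_univ_sum, Fintype.piFinset_univ]
    calc _ = ∏ i, ∑ a, p i a * Real.exp (t * L i a) := hswap
      _ ≤ ∏ i, Real.exp (t * (ε i * ((Real.exp (ε i) - 1) / (Real.exp (ε i) + 1))) +
            t ^ 2 * ε i ^ 2 / 2) := by
          refine Finset.prod_le_prod (fun i _ => Finset.sum_nonneg fun a _ =>
            mul_nonneg (hp i a) (Real.exp_pos _).le) fun i _ => ?_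
          exact sum_mul_exp_le (hp i) (hp1 i) ((h i).abs_log_div_le (hε i) (hp i) (hq i))
            ((h i).sum_mul_log_le (hε i) (hp i) (hq i) (hp1 i) (hq1 i)) ht
      _ = _ := by
          rw [← Real.exp_sum, Finset.sum_add_distrib, ← Finset.mul_sum, ← Finset.sum_div,
            ← Finset.mul_sum]
  calc ∑ z, T z * ∏ i, p i (z i)
      ≤ ∑ z, (Real.exp (m + s) * (T z * ∏ i, q i (z i)) +
          Real.exp (-(t * (m + s))) / (1 + t) *
            ∏ i, (p i (z i) * Real.exp (t * L i (z i)))) := Finset.sum_le_sum fun z _ => hpt z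
    _ = Real.exp (m + s) * (∑ z, T z * ∏ i, q i (z i)) +
          Real.exp (-(t * (m + s))) / (1 + t) *
            ∑ z : (∀ i, α i), ∏ i, (p i (z i) * Real.exp (t * L i (z i))) := by
        rw [Finset.sum_add_distrib, ← Finset.mul_sum, ← Finset.mul_sum]
    _ ≤ Real.exp (m + s) * (∑ z, T z * ∏ i, q i (z i)) +
          Real.exp (-(t * (m + s))) / (1 + t) *
            Real.exp (t * m + t ^ 2 * (∑ i, ε i ^ 2) / 2) := by gcongr
    _ = _ := by
        rw [div_mul_eq_mul_div, ← Real.exp_add]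
        ring_nf

/-- Composing pure guarantees by multiplying the pointwise bounds. -/
theorem sum_mul_prod_le_exp_sum {ι : Type*} [Fintype ι] [DecidableEq ι] {α : ι → Type*}
    [∀ i, Fintype (α i)] {ε : ι → ℝ} {p q : ∀ i, α i → ℝ}
    (h : ∀ i, Indist (ε i) (p i) (q i)) (hp : ∀ i a, 0 ≤ p i a)
    {T : (∀ i, α i) → ℝ} (hT : ∀ z, T z ∈ Set.Icc (0 : ℝ) 1) :
    ∑ z, T z * ∏ i, p i (z i) ≤ Real.exp (∑ i, ε i) * ∑ z, T z * ∏ i, q i (z i) := by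
  rw [Finset.mul_sum]
  refine Finset.sum_le_sum fun z _ => ?_
  rw [mul_left_comm, Real.exp_sum, ← Finset.prod_mul_distrib]
  exact mul_le_mul_of_nonneg_left
    (Finset.prod_le_prod (fun i _ => hp i _) fun i _ => (h i (z i)).1) (hT z).1

/-- The choice `t = s / V` of the Chernoff parameter makes the failure probability at most `δ`
for both candidate values of `s`. -/
theorem chernoff_remainder_le {V δ : ℝ} (hV : 0 < V) (hδ : δ ∈ Set.Ioo (0 : ℝ) 1) :
    ∃ t, 0 ≤ t ∧
      Real.exp (t ^ 2 * V / 2 - t * √(2 * V * min (Real.log (1 / δ))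
        (Real.log (Real.exp 1 + √V / δ)))) / (1 + t) ≤ δ := by
  obtain ⟨hδ0, hδ1⟩ := hδ
  have hsV : 0 < √V := Real.sqrt_pos.mpr hV
  have hW : 0 < √V / δ := div_pos hsV hδ0
  have ha : 0 < Real.log (1 / δ) := Real.log_pos (by rw [lt_div_iff₀ hδ0]; linarith)
  have hb : 1 < Real.log (Real.exp 1 + √V / δ) := by
    rw [Real.lt_log_iff_exp_lt (by positivity)]
    linarith
  set l := min (Real.log (1 / δ)) (Real.log (Real.exp 1 + √V / δ)) with hl
  have hl0 : 0 < l := lt_min ha (by linarith)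
  set s := √(2 * V * l) with hs
  have hs2 : s ^ 2 = 2 * V * l := Real.sq_sqrt (by positivity)
  have ht : 0 ≤ s / V := div_nonneg (Real.sqrt_nonneg _) hV.le
  refine ⟨s / V, ht, ?_⟩
  have hexp : (s / V) ^ 2 * V / 2 - s / V * s = -l := by
    field_simp
    rw [hs2]
    ring
  rw [hexp, div_le_iff₀ (by linarith)]
  rcases min_choice (Real.log (1 / δ)) (Real.log (Real.exp 1 + √V / δ)) with hc | hc
  · rw [← hl] at hc
    have : Real.exp (-l) = δ := by
      rw [hc, one_div, Real.log_inv, neg_neg, Real.exp_log hδ0]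
    rw [this]
    nlinarith
  · rw [← hl] at hc
    rw [Real.exp_neg, hc, Real.exp_log (by positivity), inv_le_iff_one_le_mul₀ (by positivity)]
    -- already the product of the terms `√V / δ` and `s / V` is large enough
    have hsV1 : √V ≤ s := by
      rw [hs]
      apply Real.sqrt_le_sqrt
      rw [hc]
      nlinarith
    have h1 : 1 ≤ √V * (s / V) := by
      rw [mul_div_assoc', le_div_iff₀ hV, one_mul]
      calc V = √V * √V := (Real.mul_self_sqrt hV.le).symm
        _ ≤ √V * s := by gcongr
    have e : δ * (1 + s / V) * (Real.exp 1 + √V / δ) =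
        δ * (1 + s / V) * Real.exp 1 + √V + √V * (s / V) := by
      field_simp
      ring
    rw [e]
    have : 0 ≤ δ * (1 + s / V) * Real.exp 1 := by positivity
    linarith

/-- Advanced composition of pure differential privacy, for product distributions on finite
sets. -/
theorem sum_mul_prod_le_epsBar {k : ℕ} {α : Fin k → Type*} [∀ i, Fintype (α i)]
    {ε : Fin k → ℝ} (hε : ∀ i, 0 ≤ ε i) {p q : ∀ i, α i → ℝ}
    (h : ∀ i, Indist (ε i) (p i) (q i))
    (hp : ∀ i a, 0 ≤ p i a) (hq : ∀ i a, 0 ≤ q i a)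
    (hp1 : ∀ i, ∑ a, p i a = 1) (hq1 : ∀ i, ∑ a, q i a = 1)
    {T : (∀ i, α i) → ℝ} (hT : ∀ z, T z ∈ Set.Icc (0 : ℝ) 1)
    {δ : ℝ} (hδ : δ ∈ Set.Ioo (0 : ℝ) 1) :
    ∑ z, T z * ∏ i, p i (z i) ≤
      Real.exp (epsBar ε δ) * ∑ z, T z * ∏ i, q i (z i) + δ := by
  have hbasic := sum_mul_prod_le_exp_sum h hp hT
  rcases (Finset.sum_nonneg fun i _ => sq_nonneg (ε i) : 0 ≤ ∑ i, ε i ^ 2).eq_or_lt with hV | hV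
  · have h0 : ∀ i, ε i = 0 := fun i => by
      have := (Finset.sum_eq_zero_iff_of_nonneg fun i _ => sq_nonneg (ε i)).mp hV.symm i
        (Finset.mem_univ i)
      simpa using this
    have e : epsBar ε δ = ∑ i, ε i := by simp [epsBar, h0]
    rw [e]
    linarith [hδ.1]
  · unfold epsBar
    rcases min_choice (∑ i, ε i)
      (∑ i, ε i * ((Real.exp (ε i) - 1) / (Real.exp (ε i) + 1)) +
      √(2 * (∑ i, ε i ^ 2) *
        min (Real.log (1 / δ)) (Real.log (Real.exp 1 + √(∑ i, ε i ^ 2) / δ)))) with hc | hc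
    · rw [hc]
      linarith [hδ.1]
    · rw [hc]
      obtain ⟨t, ht, htδ⟩ := chernoff_remainder_le hV hδ
      exact (sum_mul_prod_le_chernoff hε h hp hq hp1 hq1 hT ht _).trans (by gcongr)

/-! ### Reduction of approximate to pure differential privacy -/

/-- Auxiliary form of `exists_indist_le` for minorants that are already indistinguishable but
whose masses differ: the heavier one is lowered towards the pointwise minimum. -/
theorem exists_indist_le_of_sum_le {α : Type*} [Fintype α] {ε c : ℝ} (hε : 0 ≤ ε) (hc : 0 < c)
    {u v : α → ℝ} (hv : ∀ a, 0 ≤ v a) (h : Indist ε u v)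
    (huv : ∑ a, v a ≤ ∑ a, u a) (hcv : c ≤ ∑ a, v a) :
    ∃ p q : α → ℝ, Indist ε p q ∧ (∀ a, 0 ≤ p a) ∧ (∀ a, 0 ≤ q a) ∧
      ∑ a, p a = 1 ∧ ∑ a, q a = 1 ∧ (∀ a, c * p a ≤ u a) ∧ (∀ a, c * q a ≤ v a) := by
  have hE : 1 ≤ Real.exp ε := Real.one_le_exp hε
  have hE0 := Real.exp_pos ε
  have hu : ∀ a, 0 ≤ u a := fun a =>
    nonneg_of_mul_nonneg_right ((hv a).trans (h a).2) hE0
  set b := ∑ a, v a with hb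
  have hb0 : 0 < b := hc.trans_le hcv
  have hmin : ∑ a, min (u a) (v a) ≤ b := Finset.sum_le_sum fun a _ => min_le_right _ _
  obtain ⟨t, ht0, ht1, ht⟩ : ∃ t : ℝ, 0 ≤ t ∧ t ≤ 1 ∧
      ∑ a, ((1 - t) * u a + t * min (u a) (v a)) = b := by
    simp only [Finset.sum_add_distrib, ← Finset.mul_sum]
    set m := ∑ a, min (u a) (v a)
    set U := ∑ a, u a
    rcases huv.eq_or_lt with he | hlt
    · exact ⟨0, le_rfl, zero_le_one, by rw [he]; ring⟩
    · have hUm : 0 < U - m := by linarith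
      refine ⟨(U - b) / (U - m), div_nonneg (by linarith) hUm.le, ?_, ?_⟩
      · rw [div_le_one hUm]; linarith
      · field_simp
        ring
  set w : α → ℝ := fun a => (1 - t) * u a + t * min (u a) (v a) with hw
  have hwu : ∀ a, w a ≤ u a := fun a => by
    have := mul_le_mul_of_nonneg_left (min_le_left (u a) (v a)) ht0
    simp only [hw]; linarith
  have hw0 : ∀ a, 0 ≤ w a := fun a =>
    add_nonneg (mul_nonneg (by linarith) (hu a)) (mul_nonneg ht0 (le_min (hu a) (hv a)))
  have hwv : Indist ε w v := fun a => by
    refine ⟨(hwu a).trans (h a).1, ?_⟩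
    have h1 : v a ≤ Real.exp ε * min (u a) (v a) := by
      rcases min_choice (u a) (v a) with hh | hh <;> rw [hh]
      · exact (h a).2
      · exact le_mul_of_one_le_left (hv a) hE
    have h2 := mul_le_mul_of_nonneg_left (h a).2 (by linarith : 0 ≤ 1 - t)
    have h3 := mul_le_mul_of_nonneg_left h1 ht0
    simp only [hw]
    linarith
  have hcb : c / b ≤ 1 := (div_le_one hb0).mpr hcv
  refine ⟨fun a => w a / b, fun a => v a / b, fun a => ⟨?_, ?_⟩, fun a => div_nonneg (hw0 a) hb0.le,
    fun a => div_nonneg (hv a) hb0.le, ?_, ?_, fun a => ?_, fun a => ?_⟩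
  · rw [← mul_div_assoc]
    exact div_le_div_of_nonneg_right (hwv a).1 hb0.le
  · rw [← mul_div_assoc]
    exact div_le_div_of_nonneg_right (hwv a).2 hb0.le
  · rw [← Finset.sum_div, ht, div_self hb0.ne']
  · rw [← Finset.sum_div, ← hb, div_self hb0.ne']
  · calc c * (w a / b) = c / b * w a := by ring
      _ ≤ w a := mul_le_of_le_one_left (hw0 a) hcb
      _ ≤ u a := hwu a
  · calc c * (v a / b) = c / b * v a := by ring
      _ ≤ v a := mul_le_of_le_one_left (hv a) hcb

theorem Indist.symm {α : Type*} {ε : ℝ} {p q : α → ℝ} (h : Indist ε p q) : Indist ε q p :=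
  fun a => (h a).symm

theorem one_sub_le_sum_min {α : Type*} [Fintype α] {ε δ : ℝ} {p q : α → ℝ}
    (hp1 : ∑ a, p a = 1)
    (h : ∀ S : Finset α, ∑ a ∈ S, p a ≤ Real.exp ε * ∑ a ∈ S, q a + δ) :
    1 - δ ≤ ∑ a, min (p a) (Real.exp ε * q a) := by
  classical
  -- the excess of `p` over `exp ε * q` is collected on the set where it is positive
  have hS := h (Finset.univ.filter fun a => Real.exp ε * q a < p a)
  have h1 : ∑ a, (p a - min (p a) (Real.exp ε * q a)) =
      ∑ a ∈ Finset.univ.filter (fun a => Real.exp ε * q a < p a),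
        (p a - Real.exp ε * q a) := by
    rw [Finset.sum_filter]
    refine Finset.sum_congr rfl fun a _ => ?_
    split_ifs with ha
    · rw [min_eq_right ha.le]
    · rw [min_eq_left (not_lt.mp ha), sub_self]
  rw [Finset.sum_sub_distrib, Finset.sum_sub_distrib, ← Finset.mul_sum, hp1] at h1
  linarith

/-- Two distributions that are `(ε, δ)`-indistinguishable in both directions dominate
`1 - δ` times two `ε`-indistinguishable distributions. -/
theorem exists_indist_le {α : Type*} [Fintype α] {ε δ : ℝ} (hε : 0 ≤ ε) (hδ : δ < 1)
    {p q : α → ℝ} (hp : ∀ a, 0 ≤ p a) (hq : ∀ a, 0 ≤ q a)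
    (hp1 : ∑ a, p a = 1) (hq1 : ∑ a, q a = 1)
    (hpq : ∀ S : Finset α, ∑ a ∈ S, p a ≤ Real.exp ε * ∑ a ∈ S, q a + δ)
    (hqp : ∀ S : Finset α, ∑ a ∈ S, q a ≤ Real.exp ε * ∑ a ∈ S, p a + δ) :
    ∃ p' q' : α → ℝ, Indist ε p' q' ∧ (∀ a, 0 ≤ p' a) ∧ (∀ a, 0 ≤ q' a) ∧
      ∑ a, p' a = 1 ∧ ∑ a, q' a = 1 ∧
      (∀ a, (1 - δ) * p' a ≤ p a) ∧ (∀ a, (1 - δ) * q' a ≤ q a) := by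
  have hE : 1 ≤ Real.exp ε := Real.one_le_exp hε
  have hE0 := Real.exp_pos ε
  -- truncation of a nonnegative pair yields an indistinguishable pair
  have key : ∀ x y : ℝ, 0 ≤ x → 0 ≤ y →
      min x (Real.exp ε * y) ≤ Real.exp ε * min y (Real.exp ε * x) := by
    intro x y hx hy
    rw [mul_min_of_nonneg _ _ hE0.le]
    refine le_min (min_le_right _ _) ((min_le_left _ _).trans ?_)
    exact (le_mul_of_one_le_left hx hE).trans
      (le_mul_of_one_le_left (mul_nonneg hE0.le hx) hE)
  set u : α → ℝ := fun a => min (p a) (Real.exp ε * q a)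
  set v : α → ℝ := fun a => min (q a) (Real.exp ε * p a)
  have hu : ∀ a, 0 ≤ u a := fun a => le_min (hp a) (mul_nonneg hE0.le (hq a))
  have hv : ∀ a, 0 ≤ v a := fun a => le_min (hq a) (mul_nonneg hE0.le (hp a))
  have huv : Indist ε u v := fun a => ⟨key _ _ (hp a) (hq a), key _ _ (hq a) (hp a)⟩
  have hc : 0 < 1 - δ := by linarith
  have hup : ∀ a, u a ≤ p a := fun a => min_le_left _ _
  have hvq : ∀ a, v a ≤ q a := fun a => min_le_left _ _
  rcases le_total (∑ a, v a) (∑ a, u a) with hle | hle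
  · obtain ⟨p', q', h1, h2, h3, h4, h5, h6, h7⟩ :=
      exists_indist_le_of_sum_le hε hc hv huv hle (one_sub_le_sum_min hq1 hqp)
    exact ⟨p', q', h1, h2, h3, h4, h5, fun a => (h6 a).trans (hup a),
      fun a => (h7 a).trans (hvq a)⟩
  · obtain ⟨q', p', h1, h2, h3, h4, h5, h6, h7⟩ :=
      exists_indist_le_of_sum_le hε hc hu huv.symm hle (one_sub_le_sum_min hp1 hpq)
    exact ⟨p', q', h1.symm, h3, h2, h5, h4, fun a => (h7 a).trans (hup a),
      fun a => (h6 a).trans (hvq a)⟩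

theorem sum_prod_eq_one {ι : Type*} [Fintype ι] [DecidableEq ι] {α : ι → Type*}
    [∀ i, Fintype (α i)] {p : ∀ i, α i → ℝ} (hp1 : ∀ i, ∑ a, p i a = 1) :
    ∑ z : (∀ i, α i), ∏ i, p i (z i) = 1 := by
  have h := Finset.prod_univ_sum (fun i => (Finset.univ : Finset (α i))) p
  rw [Fintype.piFinset_univ] at h
  rw [← h]
  simp [hp1]

/-- Advanced composition of approximate differential privacy, for product distributions on finite
sets. -/
theorem sum_mul_prod_le_deltaBar {k : ℕ} {α : Fin k → Type*} [∀ i, Fintype (α i)]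
    {ε δs : Fin k → ℝ} (hε : ∀ i, 0 ≤ ε i) (hδs : ∀ i, δs i ∈ Set.Icc (0 : ℝ) 1)
    {p q : ∀ i, α i → ℝ} (hp : ∀ i a, 0 ≤ p i a) (hq : ∀ i a, 0 ≤ q i a)
    (hp1 : ∀ i, ∑ a, p i a = 1) (hq1 : ∀ i, ∑ a, q i a = 1)
    (hpq : ∀ i, ∀ S : Finset (α i),
      ∑ a ∈ S, p i a ≤ Real.exp (ε i) * ∑ a ∈ S, q i a + δs i)
    (hqp : ∀ i, ∀ S : Finset (α i),
      ∑ a ∈ S, q i a ≤ Real.exp (ε i) * ∑ a ∈ S, p i a + δs i)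
    {T : (∀ i, α i) → ℝ} (hT : ∀ z, T z ∈ Set.Icc (0 : ℝ) 1)
    {δ : ℝ} (hδ : δ ∈ Set.Ioo (0 : ℝ) 1) :
    ∑ z, T z * ∏ i, p i (z i) ≤
      Real.exp (epsBar ε δ) * ∑ z, T z * ∏ i, q i (z i) + deltaBar δs δ := by
  have hP0 : ∀ z : (∀ i, α i), 0 ≤ ∏ i, p i (z i) := fun z => Finset.prod_nonneg fun i _ => hp i _
  have hQ0 : ∀ z : (∀ i, α i), 0 ≤ ∏ i, q i (z i) := fun z => Finset.prod_nonneg fun i _ => hq i _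
  by_cases hone : ∃ i, δs i = 1
  · -- the additive error is `1`, which bounds every acceptance probability
    obtain ⟨i, hi⟩ := hone
    have hd : deltaBar δs δ = 1 := by
      rw [deltaBar, Finset.prod_eq_zero (Finset.mem_univ i) (by rw [hi, sub_self])]
      ring
    rw [hd]
    have h1 : ∑ z, T z * ∏ i, p i (z i) ≤ 1 := by
      rw [← sum_prod_eq_one hp1]
      exact Finset.sum_le_sum fun z _ => mul_le_of_le_one_left (hP0 z) (hT z).2
    have h2 : 0 ≤ Real.exp (epsBar ε δ) * ∑ z, T z * ∏ i, q i (z i) :=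
      mul_nonneg (Real.exp_pos _).le (Finset.sum_nonneg fun z _ => mul_nonneg (hT z).1 (hQ0 z))
    linarith
  push Not at hone
  have hlt : ∀ i, δs i < 1 := fun i => lt_of_le_of_ne (hδs i).2 (hone i)
  choose p' q' h hp' hq' hp1' hq1' hpp hqq using fun i =>
    exists_indist_le (hε i) (hlt i) (hp i) (hq i) (hp1 i) (hq1 i) (hpq i) (hqp i)
  set c := ∏ i, (1 - δs i) with hc
  have hc0 : 0 ≤ c := Finset.prod_nonneg fun i _ => by linarith [hlt i]
  have hPP : ∀ z : (∀ i, α i), c * ∏ i, p' i (z i) ≤ ∏ i, p i (z i) := fun z => by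
    rw [hc, ← Finset.prod_mul_distrib]
    exact Finset.prod_le_prod (fun i _ => mul_nonneg (by linarith [hlt i]) (hp' i _))
      fun i _ => hpp i _
  have hQQ : ∀ z : (∀ i, α i), c * ∏ i, q' i (z i) ≤ ∏ i, q i (z i) := fun z => by
    rw [hc, ← Finset.prod_mul_distrib]
    exact Finset.prod_le_prod (fun i _ => mul_nonneg (by linarith [hlt i]) (hq' i _))
      fun i _ => hqq i _
  -- the part of the product distribution not covered by the pure parts has mass `1 - c`
  have h1 : ∑ z, T z * ∏ i, p i (z i) ≤ c * (∑ z, T z * ∏ i, p' i (z i)) + (1 - c) := by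
    have : ∀ z : (∀ i, α i), T z * ∏ i, p i (z i) ≤
        c * (T z * ∏ i, p' i (z i)) + (∏ i, p i (z i) - c * ∏ i, p' i (z i)) := fun z => by
      have := mul_le_of_le_one_left (sub_nonneg.mpr (hPP z)) (hT z).2
      linarith
    refine (Finset.sum_le_sum fun z _ => this z).trans (le_of_eq ?_)
    rw [Finset.sum_add_distrib, Finset.sum_sub_distrib, ← Finset.mul_sum, ← Finset.mul_sum,
      sum_prod_eq_one hp1, sum_prod_eq_one hp1', mul_one]
  have h2 : c * ∑ z, T z * ∏ i, q' i (z i) ≤ ∑ z, T z * ∏ i, q i (z i) := by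
    rw [Finset.mul_sum]
    refine Finset.sum_le_sum fun z _ => ?_
    rw [mul_left_comm]
    exact mul_le_mul_of_nonneg_left (hQQ z) (hT z).1
  have h3 := mul_le_mul_of_nonneg_left
    (sum_mul_prod_le_epsBar hε h hp' hq' hp1' hq1' hT hδ) hc0
  have h4 := mul_le_mul_of_nonneg_left h2 (Real.exp_pos (epsBar ε δ)).le
  rw [deltaBar, ← hc]
  linarith

/-! ### Outcome distributions of local measurements -/

theorem trace_piTensorProduct_map {R ι : Type*} [CommRing R] [Fintype ι] [DecidableEq ι]
    {V : ι → Type*} [∀ i, AddCommGroup (V i)] [∀ i, Module R (V i)]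
    [∀ i, Module.Free R (V i)] [∀ i, Module.Finite R (V i)] (f : ∀ i, V i →ₗ[R] V i) :
    LinearMap.trace R (⨂[R] i, V i) (PiTensorProduct.map f) =
      ∏ i, LinearMap.trace R (V i) (f i) := by
  classical
  let b : ∀ i, Module.Basis (Module.Free.ChooseBasisIndex R (V i)) R (V i) :=
    fun i => Module.Free.chooseBasis R (V i)
  rw [LinearMap.trace_eq_matrix_trace R (Basis.piTensorProduct b)]
  simp_rw [fun i => LinearMap.trace_eq_matrix_trace R (b i) (f i), Matrix.trace, Matrix.diag]
  rw [Finset.prod_univ_sum, Fintype.piFinset_univ]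
  refine Finset.sum_congr rfl fun z _ => ?_
  simp [LinearMap.toMatrix_apply]

/-- The trace of a product of two positive operators is real and nonnegative. -/
theorem trace_comp_nonneg {V : Type*} [NormedAddCommGroup V] [InnerProductSpace ℂ V]
    [FiniteDimensional ℂ V] {M X : V →ₗ[ℂ] V} (hM : M.IsPositive) (hX : X.IsPositive) :
    0 ≤ LinearMap.trace ℂ V (M ∘ₗ X) := by
  rw [LinearMap.trace_eq_sum_inner _ (hX.isSymmetric.eigenvectorBasis rfl)]
  refine Finset.sum_nonneg fun i _ => ?_
  rw [LinearMap.comp_apply, LinearMap.IsSymmetric.apply_eigenvectorBasis, map_smul,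
    inner_smul_right]
  refine mul_nonneg ?_ (hM.inner_nonneg_right _)
  exact Complex.zero_le_real.mpr (hX.nonneg_eigenvalues rfl i)

theorem trMul_tensorOp {k : ℕ} {K : Fin k → Type*} [∀ i, NormedAddCommGroup (K i)]
    [∀ i, InnerProductSpace ℂ (K i)] [∀ i, FiniteDimensional ℂ (K i)]
    {M X : ∀ i, K i →ₗ[ℂ] K i} (hM : ∀ i, (M i).IsPositive) (hX : ∀ i, (X i).IsPositive) :
    trMul (tensorOp M) (tensorOp X) = ∏ i, trMul (M i) (X i) := by
  have h : ∀ i, LinearMap.trace ℂ (K i) (M i ∘ₗ X i) = (trMul (M i) (X i) : ℂ) := fun i => by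
    apply Complex.ext
    · simp [trMul]
    · simpa using (Complex.nonneg_iff.mp (trace_comp_nonneg (hM i) (hX i))).2.symm
  rw [trMul, tensorOp, tensorOp, ← PiTensorProduct.map_comp, trace_piTensorProduct_map]
  simp_rw [h]
  rw [← Complex.ofReal_prod, Complex.ofReal_re]

theorem trMul_sum {V Z : Type*} [AddCommGroup V] [Module ℂ V] (S : Finset Z)
    (M : Z → V →ₗ[ℂ] V) (X : V →ₗ[ℂ] V) :
    trMul (∑ z ∈ S, M z) X = ∑ z ∈ S, trMul (M z) X := by
  simp [trMul, ← Module.End.mul_eq_comp, Finset.sum_mul]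

theorem trMul_smul {V : Type*} [AddCommGroup V] [Module ℂ V] (t : ℝ) (M X : V →ₗ[ℂ] V) :
    trMul ((t : ℂ) • M) X = t * trMul M X := by
  simp [trMul, LinearMap.smul_comp]

/-- The outcome distribution of a product of local measurements on a product state is the product
of the local outcome distributions. -/
theorem trMul_sum_tensorOp {k : ℕ} {K : Fin k → Type*} [∀ i, NormedAddCommGroup (K i)]
    [∀ i, InnerProductSpace ℂ (K i)] [∀ i, FiniteDimensional ℂ (K i)] {n : Fin k → ℕ}
    (P : ∀ i, POVM (K i) (Fin (n i))) (T : (∀ i, Fin (n i)) → ℝ) (X : ∀ i, DensityOp (K i)) :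
    trMul (∑ z, (T z : ℂ) • tensorOp (fun i => (P i).op (z i))) (tensorOp fun i => (X i).op) =
      ∑ z, T z * ∏ i, trMul ((P i).op (z i)) (X i).op := by
  rw [trMul_sum]
  refine Finset.sum_congr rfl fun z _ => ?_
  rw [trMul_smul, trMul_tensorOp (fun i => (P i).pos _) fun i => (X i).pos]

theorem POVM.sum_trMul_eq_one {V Z : Type*} [NormedAddCommGroup V] [InnerProductSpace ℂ V]
    [Fintype Z] (P : POVM V Z) (X : DensityOp V) : ∑ z, trMul (P.op z) X.op = 1 := by
  rw [← trMul_sum, P.sum_eq_id, trMul, LinearMap.id_comp, X.trace_eq_one, Complex.one_re]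

theorem isPositive_finset_sum {V Z : Type*} [NormedAddCommGroup V] [InnerProductSpace ℂ V]
    (S : Finset Z) {M : Z → V →ₗ[ℂ] V} (hM : ∀ z, (M z).IsPositive) :
    (∑ z ∈ S, M z).IsPositive := by
  classical
  induction S using Finset.induction_on with
  | empty => simp
  | insert a S ha ih =>
    rw [Finset.sum_insert ha]
    exact (hM a).add ih

theorem POVM.isEffect_sum {V Z : Type*} [NormedAddCommGroup V] [InnerProductSpace ℂ V]
    [Fintype Z] (P : POVM V Z) (S : Finset Z) : IsEffect (∑ z ∈ S, P.op z) := by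
  classical
  refine ⟨isPositive_finset_sum S P.pos, ?_⟩
  rw [← P.sum_eq_id, ← Finset.sum_compl_add_sum S, add_sub_cancel_right]
  exact isPositive_finset_sum Sᶜ P.pos

end QDP

theorem mainTheorem9 {k : ℕ} {H K : Fin k → Type*}
    [∀ i, NormedAddCommGroup (H i)] [∀ i, InnerProductSpace ℂ (H i)]
    [∀ i, FiniteDimensional ℂ (H i)]
    [∀ i, NormedAddCommGroup (K i)] [∀ i, InnerProductSpace ℂ (K i)]
    [∀ i, FiniteDimensional ℂ (K i)]
    (N : ∀ i, QDP.DensityOp (H i) → QDP.DensityOp (H i) → Prop)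
    (hN : ∀ i ρ σ, N i ρ σ → N i σ ρ)
    (A : ∀ i, QDP.Channel (H i) (K i))
    (ε δs : Fin k → ℝ) (hε : ∀ i, 0 ≤ ε i) (hδs : ∀ i, δs i ∈ Set.Icc (0 : ℝ) 1)
    (hA : ∀ i, QDP.IsQDP (N i) (ε i) (δs i) (A i))
    (ρ σ : ∀ i, QDP.DensityOp (H i)) (hρσ : ∀ i, N i (ρ i) (σ i))
    (M : (⨂[ℂ] i, K i) →ₗ[ℂ] (⨂[ℂ] i, K i)) (hM : M ∈ QDP.LOStar K)
    (δ : ℝ) (hδ : δ ∈ Set.Ioo (0 : ℝ) 1) :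
    QDP.trMul M (QDP.tensorOp (fun i => ((A i).onState (ρ i)).op)) ≤
      Real.exp (QDP.epsBar ε δ) *
          QDP.trMul M (QDP.tensorOp (fun i => ((A i).onState (σ i)).op)) +
        QDP.deltaBar δs δ := by
  obtain ⟨n, P, T, hT, rfl⟩ := hM
  rw [QDP.trMul_sum_tensorOp P T fun i => (A i).onState (ρ i),
    QDP.trMul_sum_tensorOp P T fun i => (A i).onState (σ i)]
  have hnn : ∀ (τ : ∀ i, QDP.DensityOp (H i)) (i : Fin k) (a : Fin (n i)),
      0 ≤ QDP.trMul ((P i).op a) ((A i).onState (τ i)).op := fun τ i a =>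
    (Complex.nonneg_iff.mp
      (QDP.trace_comp_nonneg ((P i).pos a) ((A i).onState (τ i)).pos)).1
  -- every event of the local outcome distribution is an effect, so it inherits the QDP bound
  have hev : ∀ (τ τ' : ∀ i, QDP.DensityOp (H i)), (∀ i, N i (τ i) (τ' i)) →
      ∀ (i : Fin k) (S : Finset (Fin (n i))),
      ∑ a ∈ S, QDP.trMul ((P i).op a) ((A i).onState (τ i)).op ≤
        Real.exp (ε i) * ∑ a ∈ S, QDP.trMul ((P i).op a) ((A i).onState (τ' i)).op + δs i := by
    intro τ τ' hτ i S
    rw [← QDP.trMul_sum, ← QDP.trMul_sum]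
    exact hA i _ _ (hτ i) _ ((P i).isEffect_sum S)
  exact QDP.sum_mul_prod_le_deltaBar hε hδs
    (p := fun i a => QDP.trMul ((P i).op a) ((A i).onState (ρ i)).op)
    (q := fun i a => QDP.trMul ((P i).op a) ((A i).onState (σ i)).op)
    (hnn ρ) (hnn σ) (fun i => (P i).sum_trMul_eq_one _) (fun i => (P i).sum_trMul_eq_one _)
    (hev ρ σ hρσ) (hev σ ρ fun i => hN i _ _ (hρσ i)) hT hδ
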